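/- Let $\Bbbk$ be a field and $K/\Bbbk$ a field of rational functions $\Bbbk(x_1,\dots,x_n)$. A subfield $L$ with $\Bbbk\subseteq L\subseteq K$ is algebraically closed in $K$ if every element of $K$ that is algebraic over $L$ lies in $L$. An element $\psi\in K\setminus\Bbbk$ is closed if $\Bbbk(\psi)$ is algebraically closed in $K$. A generative element of $\varphi\in K\setminus\Bbbk$ is a closed $\psi$ with $\varphi=H(\psi)$ for some $H\in\Bbbk(t)$. A subfield $L$ with $\Bbbk\subseteq L\subseteq K$ is saturated in $K$ if for every $\varphi\in L\setminus\Bbbk$ the generative element of $\varphi$ (unique up to fractional linear transformations over $\Bbbk$) lies in $L$. (1) Let $\Bbbk$ be an algebraically closed field of characteristic zero and let $G\subset \mathrm{GL}_n(\Bbbk)$ be a subgroup isomorphic to the alternating group $A_5$, acting on $\Bbbk(x_1,\dots,x_n)$ by $(g\cdot f)(v)=f(g^{-1}v)$. Then the subfield of invariants $\Bbbk(x_1,\dots,x_n)^G$ is saturated in $\Bbbk(x_1,\dots,x_n)$. (2) The group of $\mathbb{C}$-automorphisms of $\mathbb{C}(x)$ contains subgroups isomorphic to $A_5$, and for every such subgroup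 $H$ (in particular for the rotation group of the icosahedron in $\mathrm{PSL}_2(\mathbb{C})\cong\mathrm{Aut}_{\mathbb{C}}\,\mathbb{C}(x)$) the field $\mathbb{C}(x)^H$ is not saturated in $\mathbb{C}(x)$. (3) On the other hand, for some $n$ there is a subgroup $G\subset\mathrm{GL}_n(\mathbb{C})$ isomorphic to $A_5$, and then $\mathbb{C}(x_1,\dots,x_n)^G$ is saturated in $\mathbb{C}(x_1,\dots,x_n)$. Hence saturation of a field of invariants is not determined by the ground field and the abstract group: it depends on the action of the group by automorphisms of the field of rational functions. -/

import Mathlib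

open IntermediateField

noncomputable section

/-- The alternating group on five letters. -/
abbrev AltFive : Type := alternatingGroup (Fin 5)

section Saturation

variable {k K : Type*} [Field k] [Field K] [Algebra k K]

/-- A subfield `L` of `K` containing `k` is algebraically closed in `K`: every element of `K`
that is algebraic over `L` belongs to `L`. -/
def AlgClosedIn (L : IntermediateField k K) : Prop :=
  ∀ y : K, IsAlgebraic L y → y ∈ L

/-- `ψ` is closed: it is not a constant, and `k(ψ)` is algebraically closed in `K`. -/
def IsClosedElement (k : Type*) {K : Type*} [Field k] [Field K] [Algebra k K] (ψ : K) : Prop :=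
  ψ ∉ (algebraMap k K).range ∧ AlgClosedIn k⟮ψ⟯

/-- `ψ` is a generative element of `φ`: it is closed, and `φ = H(ψ)` for a rational function `H`
in one variable over `k`, i.e. `φ ∈ k(ψ)`. For a nonconstant rational function `φ`, generative
elements exist and any two of them differ by a fractional linear transformation over `k`. -/
def IsGenerative (k : Type*) {K : Type*} [Field k] [Field K] [Algebra k K] (ψ φ : K) : Prop :=
  IsClosedElement k ψ ∧ φ ∈ k⟮ψ⟯

/-- The subfield `L` is saturated in `K`: for every nonconstant `φ ∈ L`, the generative element
of `φ` (any of them) is contained in `L`. -/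
def IsSaturated (L : IntermediateField k K) : Prop :=
  ∀ φ ∈ L, φ ∉ (algebraMap k K).range → ∀ ψ : K, IsGenerative k ψ φ → ψ ∈ L

end Saturation

section LinearAction

variable (k : Type*) [Field k] (n : ℕ)

/-- The field `k(x₁, …, xₙ)` of rational functions in `n` variables. -/
abbrev RationalFunctions : Type _ := FractionRing (MvPolynomial (Fin n) k)

variable {k n}

/-- The substitution `f(x) ↦ f(A x)` on polynomials: `xᵢ ↦ ∑ⱼ Aᵢⱼ xⱼ`. -/
def linSubst (A : Matrix (Fin n) (Fin n) k) :
    MvPolynomial (Fin n) k →ₐ[k] MvPolynomial (Fin n) k :=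
  MvPolynomial.aeval fun i => ∑ j, MvPolynomial.C (A i j) * MvPolynomial.X j

theorem linSubst_X (A : Matrix (Fin n) (Fin n) k) (i : Fin n) :
    linSubst A (MvPolynomial.X i) = ∑ j, MvPolynomial.C (A i j) * MvPolynomial.X j := by
  simp [linSubst]

theorem linSubst_one : linSubst (1 : Matrix (Fin n) (Fin n) k) = AlgHom.id k _ := by
  apply MvPolynomial.algHom_ext
  intro i
  rw [linSubst_X, Finset.sum_eq_single i]
  · simp
  · intro j _ h
    simp [Matrix.one_apply_ne' h]
  · simp

theorem linSubst_comp (A B : Matrix (Fin n) (Fin n) k) :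
    (linSubst B).comp (linSubst A) = linSubst (A * B) := by
  apply MvPolynomial.algHom_ext
  intro i
  simp only [AlgHom.comp_apply, linSubst_X, map_sum, map_mul, Matrix.mul_apply, Finset.mul_sum,
    Finset.sum_mul]
  rw [Finset.sum_comm]
  simp [MvPolynomial.algHom_C, MvPolynomial.algebraMap_eq, mul_assoc]

/-- The action of `GLₙ(k)` on the polynomial functions on `kⁿ`: `(g • f)(v) = f(g⁻¹ v)`. -/
def polyAction : GL (Fin n) k →* (MvPolynomial (Fin n) k ≃ₐ[k] MvPolynomial (Fin n) k) where
  toFun g := AlgEquiv.ofAlgHom (linSubst (g⁻¹ : GL (Fin n) k).1) (linSubst g.1)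
    (by rw [linSubst_comp, ← Units.val_mul, mul_inv_cancel, Units.val_one, linSubst_one])
    (by rw [linSubst_comp, ← Units.val_mul, inv_mul_cancel, Units.val_one, linSubst_one])
  map_one' := by
    ext1 f
    simp [linSubst_one]
  map_mul' g h := by
    ext1 f
    change linSubst ((g * h)⁻¹ : GL (Fin n) k).1 f =
      ((linSubst (g⁻¹ : GL (Fin n) k).1).comp (linSubst (h⁻¹ : GL (Fin n) k).1)) f
    rw [linSubst_comp, mul_inv_rev, Units.val_mul]

/-- The induced action of `GLₙ(k)` on `k(x₁, …, xₙ)` by `k`-automorphisms. -/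
def ratAction : GL (Fin n) k →* (RationalFunctions k n ≃ₐ[k] RationalFunctions k n) where
  toFun g := IsFractionRing.algEquivOfAlgEquiv (polyAction g)
  map_one' := by
    apply AlgEquiv.ext
    intro x
    obtain ⟨a, b, -, rfl⟩ := IsFractionRing.div_surjective (MvPolynomial (Fin n) k) x
    simp
  map_mul' g h := by
    apply AlgEquiv.ext
    intro x
    obtain ⟨a, b, -, rfl⟩ := IsFractionRing.div_surjective (MvPolynomial (Fin n) k) x
    simp

/-- The field of invariants `k(x₁, …, xₙ)ᴳ` of a linear group `G ⊆ GLₙ(k)`. -/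
def linInvariants (G : Subgroup (GL (Fin n) k)) : IntermediateField k (RationalFunctions k n) :=
  fixedField (G.map ratAction)

end LinearAction

end

/-!
For linear groups, let `φ` be invariant under `G ≅ A₅` and let `ψ` be a generative element of `φ`.
Each conjugate `g ψ` is algebraic over `k(φ) ⊆ k(ψ)` (`isAlgebraic_map_of_mem_adjoin`), and `k(ψ)` is
algebraically closed in `K`, so `G` acts on `k(ψ)`, that is, by fractional linear transformations
of `ψ` (`exists_moebius_of_adjoin_eq`). A priori this only gives a projective representation of
`A₅` in dimension two, and such representations may be faithful. But the action comes from the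
factorial ring of polynomials, whose units are constants: writing `ψ = P / Q` in lowest terms, the
span of `P` and `Q` is stable under `G` (`exists_linear_of_moebius`), so the projective
representation lifts to a linear one. Its determinant is trivial, and an involution of determinant
one in dimension two is `±1` (`AltFive.involution_scalar`); so an involution fixes `ψ`, and by
simplicity of `A₅` all of `G` does.

For groups of automorphisms of `k(x)` no such lifting exists. The element `x` is generative for every
nonconstant rational function, so a saturated subfield other than `k` is the whole field
(`eq_top_of_isSaturated`), which the field of invariants of a nontrivial finite group never is.

It remains to embed `A₅` into the automorphism group of `k(x)`. The space of `2 × 2` matrices with the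
determinant as quadratic form contains a regular simplex with five vertices (`simplexVertex`).
Transpositions of the vertices are reflections `X ↦ A (adj X) B`, hence even permutations are induced
by maps `X ↦ A X B` (`exists_simplexVertex_perm`). The vertices span the space, so `A` is determined
up to a scalar by the permutation, and lets `A₅` act on `k(x)` by fractional linear transformations.
-/

/-! ### Two generators of a rational function field in one variable -/

section Moebius

variable {k K : Type*} [Field k] [Field K] [Algebra k K]

/-- Two generators of a purely transcendental extension of degree one differ by a fractional
linear transformation. -/
theorem exists_moebius_of_adjoin_eq {ψ θ : K} (hψ : Transcendental k ψ) (h : k⟮θ⟯ = k⟮ψ⟯) :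
    ∃ a b c d : k, a * d - b * c ≠ 0 ∧
      algebraMap k K c * ψ + algebraMap k K d ≠ 0 ∧
      θ * (algebraMap k K c * ψ + algebraMap k K d) = algebraMap k K a * ψ + algebraMap k K b := by
  have hθ : θ ∈ k⟮ψ⟯ := h ▸ mem_adjoin_simple_self k θ
  have hψθ : ψ ∈ k⟮θ⟯ := h ▸ mem_adjoin_simple_self k ψ
  let e := RatFunc.algEquivOfTranscendental ψ hψ
  obtain ⟨f, hf⟩ := e.surjective ⟨θ, hθ⟩
  have hval (p : Polynomial k) : ((e (Polynomial.aeval f p) : k⟮ψ⟯) : K) = p.aeval θ := by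
    rw [← Polynomial.aeval_algHom_apply, hf, ← IntermediateField.coe_val,
      ← Polynomial.aeval_algHom_apply]
    rfl
  have htop : k⟮f⟯ = ⊤ := by
    rw [eq_top_iff, ← RatFunc.adjoin_X, adjoin_simple_le_iff]
    obtain ⟨r, s, hrs⟩ := (mem_adjoin_simple_iff k ψ).1 hψθ
    refine (mem_adjoin_simple_iff k _).2 ⟨r, s, e.injective (Subtype.ext ?_)⟩
    rw [RatFunc.algEquivOfTranscendental_X, map_div₀, IntermediateField.coe_div, hval, hval, hrs]
  have hdeg := f.finrank_eq_max_natDegree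
  rw [htop, IntermediateField.finrank_top] at hdeg
  obtain ⟨a, b, hn⟩ := Polynomial.exists_eq_X_add_C_of_natDegree_le_one
    (hdeg ▸ le_max_left _ _ : f.num.natDegree ≤ 1)
  obtain ⟨c, d, hd⟩ := Polynomial.exists_eq_X_add_C_of_natDegree_le_one
    (hdeg ▸ le_max_right _ _ : f.denom.natDegree ≤ 1)
  have hconst : ∀ z : k, f.num ≠ Polynomial.C z * f.denom := by
    intro z hz
    have : f = RatFunc.C z := by
      have hne := RatFunc.algebraMap_ne_zero f.denom_ne_zero
      rw [← f.num_div_denom, hz, map_mul, RatFunc.algebraMap_C]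
      field_simp
    rw [this] at hdeg
    simp at hdeg
  have hmap : θ = Polynomial.aeval ψ f.num / Polynomial.aeval ψ f.denom := by
    rw [← RatFunc.algEquivOfTranscendental_apply ψ hψ f]
    exact (congrArg Subtype.val hf).symm
  have hne : Polynomial.aeval ψ f.denom ≠ 0 := fun h0 =>
    f.denom_ne_zero ((injective_iff_map_eq_zero _).1 (transcendental_iff_injective.1 hψ) _ h0)
  have h1 : Polynomial.aeval ψ f.num = algebraMap k K a * ψ + algebraMap k K b := by
    rw [hn]; simp
  have h2 : Polynomial.aeval ψ f.denom = algebraMap k K c * ψ + algebraMap k K d := by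
    rw [hd]; simp
  refine ⟨a, b, c, d, fun hdet => ?_, h2 ▸ hne, ?_⟩
  · by_cases hc : c = 0
    · have hd0 : d ≠ 0 := by
        rintro rfl
        exact f.denom_ne_zero (by rw [hd, hc]; simp)
      have ha : a = 0 := by
        rw [hc, mul_zero, sub_zero] at hdet
        exact (mul_eq_zero.1 hdet).resolve_right hd0
      apply hconst (b / d)
      rw [hn, hd, ha, hc]
      simp [← Polynomial.C_mul, div_mul_cancel₀ b hd0]
    · apply hconst (a / c)
      have hb : b = a / c * d := by field_simp; linear_combination -hdet
      rw [hn, hd, mul_add, ← mul_assoc, ← Polynomial.C_mul, ← Polynomial.C_mul,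
        div_mul_cancel₀ a hc, ← hb]
  · rw [← h1, ← h2, hmap, div_mul_cancel₀ _ hne]

/-- If `φ = H(ψ)` is nonconstant and fixed by `σ`, then `σ ψ` is a root of the nonzero polynomial
obtained from `H(t) = φ` by clearing denominators, so it is algebraic over every field
containing `φ`. -/
theorem isAlgebraic_map_of_mem_adjoin {L : IntermediateField k K} {φ ψ : K} (hφL : φ ∈ L)
    (hφ : φ ∉ (algebraMap k K).range) (hφψ : φ ∈ k⟮ψ⟯) (σ : K ≃ₐ[k] K) (hσ : σ φ = φ) :
    IsAlgebraic L (σ ψ) := by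
  obtain ⟨r, s, hrs⟩ := (mem_adjoin_simple_iff k φ).1 hφψ
  have hs : Polynomial.aeval ψ s ≠ 0 := by
    intro h0
    exact hφ ⟨0, by rw [hrs, h0]; simp⟩
  refine ⟨Polynomial.C ⟨φ, hφL⟩ * s.map (algebraMap k L) - r.map (algebraMap k L), ?_, ?_⟩
  · intro h0
    have hs0 : s ≠ 0 := by rintro rfl; simp at hs
    have hc := congrArg (fun p => ((p.coeff s.natDegree : L) : K)) h0
    simp only [Polynomial.coeff_sub, Polynomial.coeff_C_mul, Polynomial.coeff_map,
      Polynomial.coeff_natDegree, Polynomial.coeff_zero] at hc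
    have hc' : φ * algebraMap k K s.leadingCoeff - algebraMap k K (r.coeff s.natDegree) = 0 := hc
    have hl : algebraMap k K s.leadingCoeff ≠ 0 := by
      simpa using Polynomial.leadingCoeff_ne_zero.2 hs0
    refine hφ ⟨r.coeff s.natDegree / s.leadingCoeff, ?_⟩
    rw [map_div₀, div_eq_iff hl]
    linear_combination -hc'
  · have h1 : σ φ * Polynomial.aeval (σ ψ) s = Polynomial.aeval (σ ψ) r := by
      rw [Polynomial.aeval_algHom_apply, Polynomial.aeval_algHom_apply, ← map_mul]
      congr 1
      conv_lhs => rw [hrs]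
      exact div_mul_cancel₀ _ hs
    rw [hσ] at h1
    simp only [map_sub, map_mul, Polynomial.aeval_C, Polynomial.aeval_map_algebraMap]
    rw [← h1]
    exact sub_self _

end Moebius

/-! ### Homomorphisms from the alternating group -/

/-- `A₅` is simple and not commutative, so it has no nontrivial characters. -/
theorem AltFive.hom_comm_eq_one {M : Type*} [CommMonoid M] (f : AltFive →* M) (g : AltFive) :
    f g = 1 := by
  have hker : f.toHomUnits.ker = ⊤ := by
    refine (IsSimpleGroup.eq_bot_or_eq_top_of_normal _ inferInstance).resolve_left fun hbot => ?_
    have hinj := (MonoidHom.ker_eq_bot_iff _).1 hbot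
    have hcomm : ∀ x y : AltFive, x * y = y * x := fun x y =>
      hinj (by rw [map_mul, map_mul, mul_comm])
    exact absurd hcomm (by decide)
  have := (MonoidHom.mem_ker (f := f.toHomUnits)).1 (hker ▸ Subgroup.mem_top g)
  simpa using congrArg Units.val this

theorem AltFive.exists_involution : ∃ t : AltFive, t ≠ 1 ∧ t * t = 1 := by
  decide

/-! ### Linear actions -/

section Linear

variable {k R : Type*} [Field k] [CommRing R] [Algebra k R]

/-- An invertible linear transformation of a coprime pair is a coprime pair. -/
theorem IsRelPrime.linear_transform {P Q : R} (h : IsRelPrime P Q) {a b c d : k}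
    (hdet : a * d - b * c ≠ 0) : IsRelPrime (a • P + b • Q) (c • P + d • Q) := by
  intro x h1 h2
  have hP : x ∣ (a * d - b * c) • P := by
    have : (a * d - b * c) • P = d • (a • P + b • Q) - b • (c • P + d • Q) := by
      module
    rw [this]
    exact dvd_sub (dvd_smul_of_dvd _ h1) (dvd_smul_of_dvd _ h2)
  have hQ : x ∣ (a * d - b * c) • Q := by
    have : (a * d - b * c) • Q = a • (c • P + d • Q) - c • (a • P + b • Q) := by
      module
    rw [this]
    exact dvd_sub (dvd_smul_of_dvd _ h2) (dvd_smul_of_dvd _ h1)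
  have key (S : R) (hS : x ∣ (a * d - b * c) • S) : x ∣ S := by
    simpa [smul_smul, inv_mul_cancel₀ hdet] using dvd_smul_of_dvd (a * d - b * c)⁻¹ hS
  exact h (key P hP) (key Q hQ)

/-- If an automorphism of the factorial ring `R` acts on a reduced fraction `P / Q` by a fractional
linear transformation, then it acts linearly on the pair `(P, Q)`, because a reduced
fraction determines its numerator and denominator up to a unit. -/
theorem exists_linear_of_moebius [IsDomain R] [UniqueFactorizationMonoid R]
    (hunit : ∀ u : R, IsUnit u → ∃ z : k, u = algebraMap k R z)
    {P Q : R} (hPQ : IsRelPrime P Q) (hQ : Q ≠ 0) (ρ : R ≃ₐ[k] R) {a b c d : k}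
    (hdet : a * d - b * c ≠ 0) (h : ρ P * (c • P + d • Q) = ρ Q * (a • P + b • Q)) :
    ∃ M : Matrix (Fin 2) (Fin 2) k,
      ρ P = M 0 0 • P + M 0 1 • Q ∧ ρ Q = M 1 0 • P + M 1 1 • Q := by
  have hrel := hPQ.linear_transform hdet
  have hρ : IsRelPrime (ρ Q) (ρ P) := by
    intro x h1 h2
    have h1' := map_dvd ρ.symm h1
    have h2' := map_dvd ρ.symm h2
    rw [AlgEquiv.symm_apply_apply] at h1' h2'
    simpa using (hPQ h2' h1').map ρ
  have hρQ : ρ Q ≠ 0 := by simpa using hQ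
  have hdvd : ρ Q ∣ c • P + d • Q := hρ.dvd_of_dvd_mul_left ⟨_, h⟩
  have hdvd' : c • P + d • Q ∣ ρ Q :=
    hrel.symm.dvd_of_dvd_mul_right ⟨ρ P, by rw [← h, mul_comm]⟩
  obtain ⟨u, hu⟩ := associated_of_dvd_dvd hdvd' hdvd
  obtain ⟨z, hz⟩ := hunit u u.isUnit
  have hQ' : ρ Q = z • (c • P + d • Q) := by
    rw [← hu, hz, Algebra.smul_def z, mul_comm]
  have hne : c • P + d • Q ≠ 0 := by
    intro h0
    rw [hQ', h0, smul_zero] at hρQ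
    exact hρQ rfl
  have hP' : ρ P = z • (a • P + b • Q) := by
    apply mul_right_cancel₀ hne
    rw [h, hQ', smul_mul_assoc, smul_mul_assoc, mul_comm]
  exact ⟨!![z * a, z * b; z * c, z * d], by simp [hP', smul_add, smul_smul],
    by simp [hQ', smul_add, smul_smul]⟩

/-- A `2 × 2` matrix of determinant one whose square is one equals its adjugate, hence is scalar. -/
theorem Matrix.fin_two_of_mul_self_eq_one [CharZero k] {M : Matrix (Fin 2) (Fin 2) k}
    (hM : M * M = 1) (hdet : M.det = 1) : M 0 1 = 0 ∧ M 1 0 = 0 ∧ M 0 0 = M 1 1 := by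
  have hadj : M.adjugate = M := by
    calc M.adjugate = M.adjugate * (M * M) := by rw [hM, mul_one]
      _ = M := by rw [← mul_assoc, Matrix.adjugate_mul, hdet, one_smul, one_mul]
  rw [Matrix.adjugate_fin_two] at hadj
  have h01 := congrFun (congrFun hadj 0) 1
  have h10 := congrFun (congrFun hadj 1) 0
  have h00 := congrFun (congrFun hadj 0) 0
  simp at h01 h10 h00
  exact ⟨self_eq_neg.1 h01.symm, self_eq_neg.1 h10.symm, h00.symm⟩

/-- If `A₅` acts linearly on a pair of independent elements `P`, `Q`, then each involution acts by
a scalar: the determinant is a character of `A₅`, hence trivial, and an involution of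
determinant one in dimension two is `±1`. -/
theorem AltFive.involution_scalar [CharZero k] {P Q : R} (hlin : LinearIndependent k ![P, Q])
    (ρ : AltFive →* (R ≃ₐ[k] R))
    (h : ∀ g, ∃ M : Matrix (Fin 2) (Fin 2) k,
      ρ g P = M 0 0 • P + M 0 1 • Q ∧ ρ g Q = M 1 0 • P + M 1 1 • Q)
    {t : AltFive} (ht : t * t = 1) : ∃ z : k, ρ t P = z • P ∧ ρ t Q = z • Q := by
  choose M hP hQ using h
  have huniq {a b c d : k} (hab : a • P + b • Q = c • P + d • Q) : a = c ∧ b = d :=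
    hlin.eq_of_pair hab
  have hone : M 1 = 1 := by
    have h1 := hP 1
    have h2 := hQ 1
    rw [map_one, AlgEquiv.one_apply] at h1 h2
    obtain ⟨h3, h4⟩ := huniq ((show (1 : k) • P + (0 : k) • Q = P by simp).trans h1)
    obtain ⟨h5, h6⟩ := huniq ((show (0 : k) • P + (1 : k) • Q = Q by simp).trans h2)
    ext i j
    fin_cases i <;> fin_cases j <;> simp [← h3, ← h4, ← h5, ← h6]
  -- The matrices describe the action on the basis in rows, whence the reversed order.
  have hmul (g g' : AltFive) : M (g * g') = M g' * M g := by
    have h1 := hP (g * g')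
    have h2 := hQ (g * g')
    rw [map_mul, AlgEquiv.mul_apply] at h1 h2
    rw [hP g', map_add, map_smul, map_smul, hP g, hQ g] at h1
    rw [hQ g', map_add, map_smul, map_smul, hP g, hQ g] at h2
    obtain ⟨h3, h4⟩ := huniq ((show (M g' 0 0 * M g 0 0 + M g' 0 1 * M g 1 0) • P +
      (M g' 0 0 * M g 0 1 + M g' 0 1 * M g 1 1) • Q = _ by module).trans h1)
    obtain ⟨h5, h6⟩ := huniq ((show (M g' 1 0 * M g 0 0 + M g' 1 1 * M g 1 0) • P +
      (M g' 1 0 * M g 0 1 + M g' 1 1 * M g 1 1) • Q = _ by module).trans h2)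
    ext i j
    fin_cases i <;> fin_cases j <;> simp [← h3, ← h4, ← h5, ← h6, Matrix.mul_apply]
  let δ : AltFive →* k :=
    { toFun := fun g => (M g).det
      map_one' := by rw [hone, Matrix.det_one]
      map_mul' := fun g g' => by rw [hmul, Matrix.det_mul, mul_comm] }
  have hdet : (M t).det = 1 := AltFive.hom_comm_eq_one δ t
  obtain ⟨h1, h2, h3⟩ := Matrix.fin_two_of_mul_self_eq_one
    (by rw [← hmul, ht, hone]) hdet
  exact ⟨M t 0 0, by rw [hP, h1, zero_smul, add_zero], by rw [hQ, h2, h3, zero_smul, zero_add]⟩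

/-- Let `A₅` act on the factorial ring `R` whose units are constants. An element `ψ` of the
fraction field of `R` such that `k(ψ)` is stable under `A₅` is invariant. -/
theorem AltFive.map_eq_self_of_forall_mem_adjoin [CharZero k] [IsDomain R]
    [UniqueFactorizationMonoid R] {K : Type*} [Field K] [Algebra R K] [IsFractionRing R K]
    [Algebra k K] [IsScalarTower k R K]
    (hunit : ∀ u : R, IsUnit u → ∃ z : k, u = algebraMap k R z)
    (ρ : AltFive →* (R ≃ₐ[k] R)) (τ : AltFive →* (K ≃ₐ[k] K))
    (hτ : ∀ g p, τ g (algebraMap R K p) = algebraMap R K (ρ g p))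
    {ψ : K} (hψ : Transcendental k ψ) (hst : ∀ g, τ g ψ ∈ k⟮ψ⟯) (g : AltFive) : τ g ψ = ψ := by
  obtain ⟨P, ⟨Q, hQmem⟩, hPQ, rfl⟩ := IsFractionRing.exists_reduced_fraction R ψ
  have hQ : Q ≠ 0 := nonZeroDivisors.ne_zero hQmem
  rw [IsFractionRing.mk'_eq_div] at *
  simp only at *
  have hQK : algebraMap R K Q ≠ 0 := by simpa using hQ
  have hsmul (z : k) (p : R) : algebraMap R K (z • p) = algebraMap k K z * algebraMap R K p := by
    rw [Algebra.smul_def, map_mul, ← IsScalarTower.algebraMap_apply]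
  set ψ : K := algebraMap R K P / algebraMap R K Q with hψdef
  have hτψ (g) : τ g ψ = algebraMap R K (ρ g P) / algebraMap R K (ρ g Q) := by
    rw [hψdef, map_div₀, hτ, hτ]
  have hadj (g : AltFive) : k⟮τ g ψ⟯ = k⟮ψ⟯ := by
    refine le_antisymm (adjoin_simple_le_iff.2 (hst g)) (adjoin_simple_le_iff.2 ?_)
    have h1 : τ g (τ g⁻¹ ψ) = ψ := by
      rw [← AlgEquiv.mul_apply, ← map_mul, mul_inv_cancel, map_one, AlgEquiv.one_apply]
    have h2 : k⟮ψ⟯ ≤ k⟮τ g ψ⟯.comap (τ g : K →ₐ[k] K) :=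
      adjoin_simple_le_iff.2 (mem_adjoin_simple_self k (τ g ψ))
    have h3 : τ g (τ g⁻¹ ψ) ∈ k⟮τ g ψ⟯ := h2 (hst g⁻¹)
    rwa [h1] at h3
  have hlin : LinearIndependent k ![P, Q] := by
    rw [LinearIndependent.pair_iff]
    intro a b hab
    have hab' : algebraMap k K a * ψ + algebraMap k K b = 0 := by
      have := congrArg (algebraMap R K) hab
      rw [map_add, hsmul, hsmul, map_zero] at this
      rw [hψdef]
      field_simp
      linear_combination this
    have h0 : (Polynomial.C a * Polynomial.X + Polynomial.C b : Polynomial k) = 0 := by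
      apply (injective_iff_map_eq_zero _).1 (transcendental_iff_injective.1 hψ)
      simpa using hab'
    refine ⟨?_, ?_⟩
    · simpa using congrArg (fun p => Polynomial.coeff p 1) h0
    · simpa using congrArg (fun p => Polynomial.coeff p 0) h0
  have hmat (g : AltFive) : ∃ M : Matrix (Fin 2) (Fin 2) k,
      ρ g P = M 0 0 • P + M 0 1 • Q ∧ ρ g Q = M 1 0 • P + M 1 1 • Q := by
    obtain ⟨a, b, c, d, hdet, -, h⟩ := exists_moebius_of_adjoin_eq hψ (hadj g)
    refine exists_linear_of_moebius hunit hPQ hQ (ρ g) hdet ?_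
    apply IsFractionRing.injective R K
    have hρQ : algebraMap R K (ρ g Q) ≠ 0 := by simpa using hQ
    rw [hτψ, hψdef] at h
    simp only [map_mul, map_add, hsmul]
    field_simp at h
    linear_combination h
  -- The kernel of the action of `A₅` on `k(ψ)` contains an involution, hence is everything.
  let N : Subgroup AltFive := (fixingSubgroup k⟮ψ⟯).comap τ
  have hmemN {g} : g ∈ N ↔ τ g ψ = ψ := by
    rw [Subgroup.mem_comap, IntermediateField.mem_fixingSubgroup_iff]
    refine ⟨fun h => h ψ (mem_adjoin_simple_self k ψ), fun h y hy => ?_⟩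
    exact (forall_mem_adjoin_smul_eq_self_iff (F := k) (S := {ψ}) (τ g)).2 (by simpa using h) y hy
  have hN : N.Normal := by
    refine ⟨fun n hn g => hmemN.2 ?_⟩
    have h1 : τ n (τ g⁻¹ ψ) = τ g⁻¹ ψ :=
      (IntermediateField.mem_fixingSubgroup_iff _ _).1 (Subgroup.mem_comap.1 hn) _ (hst g⁻¹)
    rw [map_mul, map_mul, AlgEquiv.mul_apply, AlgEquiv.mul_apply, h1, ← AlgEquiv.mul_apply,
      ← map_mul, mul_inv_cancel, map_one, AlgEquiv.one_apply]
  obtain ⟨t, ht1, ht⟩ := AltFive.exists_involution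
  obtain ⟨z, hzP, hzQ⟩ := AltFive.involution_scalar hlin ρ hmat ht
  have hz : algebraMap k K z ≠ 0 := by
    intro h0
    have : z = 0 := by simpa using h0
    rw [this, zero_smul] at hzQ
    exact hQ (by simpa using hzQ)
  have htN : t ∈ N := by
    rw [hmemN, hτψ, hzP, hzQ, hsmul, hsmul, mul_div_mul_left _ _ hz]
  have htop : N = ⊤ := hN.eq_bot_or_eq_top.resolve_left fun hbot =>
    ht1 (Subgroup.mem_bot.1 (hbot ▸ htN))
  exact hmemN.1 (htop ▸ Subgroup.mem_top g)

end Linear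

/-- If `φ` is invariant and `ψ` is a generative element of `φ`, then the conjugates of `ψ` are
algebraic over `k(ψ)`, hence belong to it because `ψ` is closed. So `k(ψ)` is stable under `G`. -/
theorem isSaturated_linInvariants_of_altFive {k : Type*} [Field k] [IsAlgClosed k] [CharZero k]
    {n : ℕ} (G : Subgroup (GL (Fin n) k)) (e : G ≃* AltFive) :
    IsSaturated (linInvariants G) := by
  intro φ hφ hφk ψ hψ
  let ι : AltFive →* GL (Fin n) k := G.subtype.comp e.symm.toMonoidHom
  have hι (g : AltFive) : ι g ∈ G := (e.symm g).2
  have hfix (g : AltFive) : ratAction (ι g) φ = φ := hφ ⟨_, Subgroup.mem_map_of_mem _ (hι g)⟩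
  have htr : Transcendental k ψ := fun halg => hψ.1.1 <| by
    exact minpoly.mem_range_of_degree_eq_one k ψ
      (IsAlgClosed.degree_eq_one_of_irreducible k (minpoly.irreducible halg.isIntegral))
  have hinv := AltFive.map_eq_self_of_forall_mem_adjoin (R := MvPolynomial (Fin n) k)
    (fun u hu => by
      obtain ⟨r, -, hr⟩ := MvPolynomial.isUnit_iff_eq_C_of_isReduced.1 hu
      exact ⟨r, hr⟩)
    (polyAction.comp ι) (ratAction.comp ι)
    (fun g p => IsFractionRing.algEquivOfAlgEquiv_algebraMap _ _) htr
    (fun g => hψ.1.2 _ (isAlgebraic_map_of_mem_adjoin hψ.2 hφk hψ.2 _ (hfix g)))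
  rintro ⟨_, g, hg, rfl⟩
  have h := hinv (e ⟨g, hg⟩)
  simp only [ι, MonoidHom.comp_apply, MulEquiv.coe_toMonoidHom, MulEquiv.symm_apply_apply,
    Subgroup.coe_subtype] at h
  exact h

/-! ### Automorphisms of the rational function field in one variable -/

section MoebiusAction

variable {k : Type*} [Field k]

theorem RatFunc.algHom_ext_X {L : Type*} [Field L] [Algebra k L] {f g : RatFunc k →ₐ[k] L}
    (h : f RatFunc.X = g RatFunc.X) : f = g := by
  apply IsLocalization.algHom_ext (nonZeroDivisors (Polynomial k))
  apply Polynomial.algHom_ext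
  change f (algebraMap _ _ Polynomial.X) = g (algebraMap _ _ Polynomial.X)
  rwa [RatFunc.algebraMap_X]

/-- The rational function `(a X + b) / (c X + d)` given by a matrix with rows `(a, b)` and `(c, d)`.
It is meaningful for `(c, d) ≠ 0`, in particular for invertible matrices. -/
noncomputable def moebius (A : Matrix (Fin 2) (Fin 2) k) : RatFunc k :=
  (RatFunc.C (A 0 0) * RatFunc.X + RatFunc.C (A 0 1)) /
    (RatFunc.C (A 1 0) * RatFunc.X + RatFunc.C (A 1 1))

theorem RatFunc.C_mul_X_add_C_eq_zero {a b : k}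
    (h : RatFunc.C a * RatFunc.X + RatFunc.C b = 0) : a = 0 ∧ b = 0 := by
  have h0 : (Polynomial.C a * Polynomial.X + Polynomial.C b : Polynomial k) = 0 := by
    apply RatFunc.algebraMap_injective k
    simpa using h
  refine ⟨?_, ?_⟩
  · simpa using congrArg (fun p => Polynomial.coeff p 1) h0
  · simpa using congrArg (fun p => Polynomial.coeff p 0) h0

theorem moebius_denom_ne_zero (A : GL (Fin 2) k) :
    RatFunc.C (A 1 0) * RatFunc.X + RatFunc.C (A 1 1) ≠ 0 := by
  intro h
  obtain ⟨h1, h2⟩ := RatFunc.C_mul_X_add_C_eq_zero h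
  have hdet := A.det.ne_zero
  rw [Matrix.GeneralLinearGroup.val_det_apply, Matrix.det_fin_two, h1, h2] at hdet
  simp at hdet

theorem transcendental_moebius (A : GL (Fin 2) k) : Transcendental k (moebius A.1) := by
  apply RatFunc.transcendental_of_ne_C
  rintro ⟨e, he⟩
  rw [moebius, div_eq_iff (moebius_denom_ne_zero A)] at he
  have h0 : RatFunc.C (A 0 0 - e * A 1 0) * RatFunc.X + RatFunc.C (A 0 1 - e * A 1 1) = 0 := by
    simp only [map_sub, map_mul]
    linear_combination he
  obtain ⟨h1, h2⟩ := RatFunc.C_mul_X_add_C_eq_zero h0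
  have hdet := A.det.ne_zero
  rw [Matrix.GeneralLinearGroup.val_det_apply, Matrix.det_fin_two] at hdet
  apply hdet
  linear_combination A 1 1 * h1 - A 1 0 * h2

/-- The substitution `f(X) ↦ f((a X + b) / (c X + d))`, obtained from the isomorphism of `k(X)` with
its subfield generated by the transcendental element `(a X + b) / (c X + d)`. -/
noncomputable def moebiusHom (A : GL (Fin 2) k) : RatFunc k →ₐ[k] RatFunc k :=
  (k⟮moebius A.1⟯.val).comp
    (RatFunc.algEquivOfTranscendental _ (transcendental_moebius A)).toAlgHom

theorem moebiusHom_X (A : GL (Fin 2) k) : moebiusHom A RatFunc.X = moebius A.1 :=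
  RatFunc.algEquivOfTranscendental_X _ _

theorem moebiusHom_C (A : GL (Fin 2) k) (z : k) : moebiusHom A (RatFunc.C z) = RatFunc.C z :=
  (moebiusHom A).commutes z

theorem moebiusHom_one : moebiusHom (1 : GL (Fin 2) k) = AlgHom.id k _ := by
  apply RatFunc.algHom_ext_X
  simp [moebiusHom_X, moebius]

theorem moebiusHom_comp (A B : GL (Fin 2) k) :
    (moebiusHom B).comp (moebiusHom A) = moebiusHom (A * B) := by
  apply RatFunc.algHom_ext_X
  have hB := moebius_denom_ne_zero B
  have hAB := moebius_denom_ne_zero (A * B)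
  have hBA : moebiusHom B (RatFunc.C (A 1 0) * RatFunc.X + RatFunc.C (A 1 1)) ≠ 0 :=
    (map_ne_zero_iff _ (moebiusHom B).injective).2 (moebius_denom_ne_zero A)
  have hmul := div_mul_cancel₀ (RatFunc.C (B 0 0) * RatFunc.X + RatFunc.C (B 0 1)) hB
  simp only [AlgHom.comp_apply, moebiusHom_X]
  rw [moebius, map_div₀, moebius, div_eq_div_iff hBA hAB]
  simp only [map_add, map_mul, moebiusHom_X, moebiusHom_C, Units.val_mul,
    Matrix.mul_apply, Fin.sum_univ_two]
  change moebius B.1 * _ = _ at hmul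
  linear_combination (RatFunc.C (A 0 0) * RatFunc.C (A 1 1) -
    RatFunc.C (A 0 1) * RatFunc.C (A 1 0)) * hmul

/-- The action of `GL₂(k)` on `k(x)` by fractional linear substitutions,
`(g • f)(x) = f(g⁻¹ x)`. -/
noncomputable def moebiusAction : GL (Fin 2) k →* (RatFunc k ≃ₐ[k] RatFunc k) where
  toFun g := AlgEquiv.ofAlgHom (moebiusHom g⁻¹) (moebiusHom g)
    (by rw [moebiusHom_comp, mul_inv_cancel, moebiusHom_one])
    (by rw [moebiusHom_comp, inv_mul_cancel, moebiusHom_one])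
  map_one' := by
    ext1 f
    simp [moebiusHom_one]
  map_mul' g h := by
    ext1 f
    change moebiusHom (g * h)⁻¹ f = ((moebiusHom g⁻¹).comp (moebiusHom h⁻¹)) f
    rw [moebiusHom_comp, mul_inv_rev]

theorem moebiusAction_eq_one_iff (g : GL (Fin 2) k) :
    moebiusAction g = 1 ↔ g 0 1 = 0 ∧ g 1 0 = 0 ∧ g 0 0 = g 1 1 := by
  have h1 : moebiusAction g = 1 ↔ moebiusHom g = AlgHom.id k _ := by
    rw [← inv_eq_one, ← map_inv]
    constructor
    · intro h
      ext1 f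
      have := AlgEquiv.congr_fun h f
      change moebiusHom (g⁻¹)⁻¹ f = f at this
      rwa [inv_inv] at this
    · intro h
      ext1 f
      change moebiusHom (g⁻¹)⁻¹ f = f
      rw [inv_inv, h, AlgHom.id_apply]
  have h2 : moebiusHom g = AlgHom.id k _ ↔ moebius g.1 = RatFunc.X :=
    ⟨fun h => by rw [← moebiusHom_X, h, AlgHom.id_apply],
      fun h => RatFunc.algHom_ext_X (by rw [moebiusHom_X, h, AlgHom.id_apply])⟩
  rw [h1, h2, moebius, div_eq_iff (moebius_denom_ne_zero g)]
  constructor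
  · intro h
    have h0 : (Polynomial.C (g 1 0) * Polynomial.X ^ 2 + Polynomial.C (g 1 1 - g 0 0) *
        Polynomial.X - Polynomial.C (g 0 1) : Polynomial k) = 0 := by
      apply RatFunc.algebraMap_injective k
      simp only [map_sub, map_add, map_mul, map_pow, RatFunc.algebraMap_C, RatFunc.algebraMap_X,
        map_zero]
      linear_combination -h
    have e0 := congrArg (fun p => Polynomial.coeff p 0) h0
    have e1 := congrArg (fun p => Polynomial.coeff p 1) h0
    have e2 := congrArg (fun p => Polynomial.coeff p 2) h0
    simp [Polynomial.coeff_X, Polynomial.coeff_C, sub_eq_zero] at e0 e1 e2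
    exact ⟨e0, e2, e1.symm⟩
  · rintro ⟨h01, h10, h00⟩
    rw [h01, h10, h00]
    simp [mul_comm]

end MoebiusAction

/-! ### An icosahedral group of automorphisms -/

section Icosahedral

open Matrix Equiv

variable {k : Type*} [Field k]

/-- The five vertices of a regular simplex in the four-dimensional quadratic space of `2 × 2`
matrices with the determinant as quadratic form, for `z` a primitive fifth root of unity. -/
def simplexVertex (z : k) (i : Fin 5) : Matrix (Fin 2) (Fin 2) k :=
  !![z ^ (i : ℕ), z ^ (2 * i : ℕ); -z ^ (3 * i : ℕ), z ^ (4 * i : ℕ)]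

theorem IsPrimitiveRoot.pow_four_eq {z : k} (hz : IsPrimitiveRoot z 5) :
    z ^ 4 = -1 - z - z ^ 2 - z ^ 3 := by
  have h := hz.geom_sum_eq_zero (by norm_num)
  simp only [Finset.sum_range_succ, Finset.sum_range_zero] at h
  linear_combination h

theorem trace_simplexVertex {z : k} (hz : IsPrimitiveRoot z 5) (i j : Fin 5) :
    (simplexVertex z i * (simplexVertex z j).adjugate).trace = if i = j then 4 else -1 := by
  have h5 : z ^ 5 = 1 := hz.pow_eq_one
  have h4 := IsPrimitiveRoot.pow_four_eq hz
  have hred : ∀ m : ℕ, z ^ m = z ^ (m % 5) := fun m => pow_eq_pow_mod m h5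
  simp only [simplexVertex, adjugate_fin_two_of, Matrix.trace_fin_two, Matrix.mul_apply,
    Fin.sum_univ_two]
  simp only [Matrix.of_apply, Matrix.cons_val', Matrix.cons_val_zero, Matrix.cons_val_one,
    Matrix.cons_val_fin_one, neg_mul, mul_neg, neg_neg, ← pow_add]
  rw [hred (i + 4 * j), hred (2 * i + 3 * j), hred (3 * i + 2 * j), hred (4 * i + j)]
  fin_cases i <;> fin_cases j <;> norm_num <;> linear_combination h4

/-- For `2 × 2` matrices, `-N (adj X) N` is up to the factor `det N` the reflection of `X` in the
hyperplane orthogonal to `N`. -/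
theorem mul_adjugate_mul_fin_two (N X : Matrix (Fin 2) (Fin 2) k) :
    N * X.adjugate * N = (X * N.adjugate).trace • N - N.det • X := by
  ext i j
  fin_cases i <;> fin_cases j <;>
  simp [Matrix.mul_apply, Matrix.adjugate_fin_two, Matrix.trace_fin_two, Matrix.det_fin_two,
    Fin.sum_univ_two] <;> ring

theorem adjugate_sub_fin_two (M N : Matrix (Fin 2) (Fin 2) k) :
    (M - N).adjugate = M.adjugate - N.adjugate := by
  ext i j
  fin_cases i <;> fin_cases j <;> simp [Matrix.adjugate_fin_two] <;> ring

theorem det_simplexVertex_sub [CharZero k] {z : k} (hz : IsPrimitiveRoot z 5) {x y : Fin 5}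
    (hxy : x ≠ y) : (simplexVertex z x - simplexVertex z y).det = 5 := by
  have hdet (N : Matrix (Fin 2) (Fin 2) k) : 2 * N.det = (N * N.adjugate).trace := by
    rw [Matrix.mul_adjugate, Matrix.trace_smul, Matrix.trace_one]
    simp [mul_comm]
  have h2 : (2 : k) ≠ 0 := two_ne_zero
  apply mul_left_cancel₀ h2
  rw [hdet, adjugate_sub_fin_two, sub_mul, mul_sub, mul_sub]
  simp only [Matrix.trace_sub, trace_simplexVertex hz, if_neg hxy, if_neg hxy.symm, if_true]
  norm_num

/-- A transposition of two vertices of the simplex is the reflection in the hyperplane orthogonal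
to their difference. -/
theorem simplexVertex_swap [CharZero k] {z : k} (hz : IsPrimitiveRoot z 5) {x y : Fin 5}
    (hxy : x ≠ y) (i : Fin 5) :
    simplexVertex z (swap x y i) = (-(5 : k)⁻¹) • ((simplexVertex z x - simplexVertex z y) *
      (simplexVertex z i).adjugate * (simplexVertex z x - simplexVertex z y)) := by
  have h5 : (5 : k) ≠ 0 := by norm_num
  rw [mul_adjugate_mul_fin_two, det_simplexVertex_sub hz hxy, adjugate_sub_fin_two, mul_sub,
    Matrix.trace_sub, trace_simplexVertex hz, trace_simplexVertex hz]
  rcases eq_or_ne i x with rfl | hix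
  · rw [swap_apply_left, if_pos rfl, if_neg hxy]
    have : (4 - -1 : k) = 5 := by norm_num
    rw [this, ← smul_sub, smul_smul, neg_mul, inv_mul_cancel₀ h5]
    module
  rcases eq_or_ne i y with rfl | hiy
  · rw [swap_apply_right, if_pos rfl, if_neg hix]
    have : (-1 - 4 : k) = -5 := by norm_num
    rw [this, neg_smul, show (-5 : k) • (simplexVertex z x - simplexVertex z i) -
      (5 : k) • simplexVertex z i = (-5 : k) • simplexVertex z x by module, smul_smul,
      mul_neg, inv_mul_cancel₀ h5]
    module
  · rw [swap_apply_of_ne_of_ne hix hiy, if_neg hix, if_neg hiy, sub_self, zero_smul, zero_sub,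
      smul_neg, smul_smul, neg_mul, inv_mul_cancel₀ h5]
    module

/-- Even permutations of the vertices are induced by maps `X ↦ A X B`, and odd ones by
`X ↦ A (adj X) B`. -/
theorem exists_simplexVertex_perm [CharZero k] {z : k} (hz : IsPrimitiveRoot z 5)
    (σ : Perm (Fin 5)) :
    (Perm.sign σ = 1 ∧ ∃ A B : GL (Fin 2) k, ∀ i,
      simplexVertex z (σ i) = A.1 * simplexVertex z i * B.1) ∨
    (Perm.sign σ = -1 ∧ ∃ A B : GL (Fin 2) k, ∀ i,
      simplexVertex z (σ i) = A.1 * (simplexVertex z i).adjugate * B.1) := by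
  have hunit (A : GL (Fin 2) k) : IsUnit A.1.adjugate.det := by
    rw [Matrix.det_adjugate]
    exact ((Matrix.isUnit_iff_isUnit_det _).1 A.isUnit).pow _
  induction σ using Perm.swap_induction_on with
  | one => exact Or.inl ⟨Perm.sign_one, 1, 1, fun i => by simp⟩
  | swap_mul σ x y hxy ih =>
    have hNdet : IsUnit (simplexVertex z x - simplexVertex z y).det := by
      rw [det_simplexVertex_sub hz hxy]
      norm_num
    have hN'det : IsUnit ((-(5 : k)⁻¹) • (simplexVertex z x - simplexVertex z y)).det := by
      rw [Matrix.det_smul, IsUnit.mul_iff]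
      exact ⟨by norm_num, hNdet⟩
    have hstep (i : Fin 5) : simplexVertex z ((swap x y * σ) i) =
        ((-(5 : k)⁻¹) • (simplexVertex z x - simplexVertex z y)) *
          (simplexVertex z (σ i)).adjugate * (simplexVertex z x - simplexVertex z y) := by
      rw [Perm.mul_apply, simplexVertex_swap hz hxy, smul_mul_assoc, smul_mul_assoc]
    have hN' := hN'det
    generalize (-(5 : k)⁻¹) • (simplexVertex z x - simplexVertex z y) = N' at hstep hN'
    generalize simplexVertex z x - simplexVertex z y = N at hstep hNdet
    rcases ih with ⟨hs, A, B, h⟩ | ⟨hs, A, B, h⟩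
    · refine Or.inr ⟨by rw [map_mul, Perm.sign_swap hxy, hs, mul_one],
        GeneralLinearGroup.mk'' (N' * B.1.adjugate) ?_,
        GeneralLinearGroup.mk'' (A.1.adjugate * N) ?_, fun i => ?_⟩
      · rw [Matrix.det_mul]; exact hN'.mul (hunit B)
      · rw [Matrix.det_mul]; exact (hunit A).mul hNdet
      · rw [hstep, h, Matrix.adjugate_mul_distrib, Matrix.adjugate_mul_distrib]
        change _ = N' * B.1.adjugate * (simplexVertex z i).adjugate * (A.1.adjugate * N)
        simp only [mul_assoc]
    · refine Or.inl ⟨by rw [map_mul, Perm.sign_swap hxy, hs]; rfl,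
        GeneralLinearGroup.mk'' (N' * B.1.adjugate) ?_,
        GeneralLinearGroup.mk'' (A.1.adjugate * N) ?_, fun i => ?_⟩
      · rw [Matrix.det_mul]; exact hN'.mul (hunit B)
      · rw [Matrix.det_mul]; exact (hunit A).mul hNdet
      · rw [hstep, h, Matrix.adjugate_mul_distrib, Matrix.adjugate_mul_distrib,
          Matrix.adjugate_adjugate _ (by simp)]
        change _ = N' * B.1.adjugate * simplexVertex z i * (A.1.adjugate * N)
        simp [mul_assoc]

/-- Triples `(σ, A, B)` such that the permutation `σ` of the vertices of the simplex is induced by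
the map `X ↦ A X B⁻¹`. -/
def simplexGroup (z : k) : Subgroup (AltFive × GL (Fin 2) k × GL (Fin 2) k) where
  carrier := {p | ∀ i, simplexVertex z (p.1.1 i) * p.2.2.1 = p.2.1.1 * simplexVertex z i}
  one_mem' i := by simp
  mul_mem' {p q} hp hq i := by
    have h1 := hp (q.1.1 i)
    have h2 := hq i
    simp only [Prod.fst_mul, Prod.snd_mul, Units.val_mul, Subgroup.coe_mul, Perm.mul_apply]
    rw [← mul_assoc, h1, mul_assoc, h2, mul_assoc]
  inv_mem' {p} hp i := by
    have h1 := hp (p.1.1⁻¹ i)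
    rw [← Perm.mul_apply, mul_inv_cancel, Perm.one_apply] at h1
    change simplexVertex z (p.1.1⁻¹ i) * (p.2.2⁻¹ : GL (Fin 2) k).1 =
      (p.2.1⁻¹ : GL (Fin 2) k).1 * simplexVertex z i
    rw [Units.mul_inv_eq_iff_eq_mul, mul_assoc, h1, ← mul_assoc, Units.inv_mul, one_mul]

theorem simplexGroup_fst_surjective [CharZero k] {z : k} (hz : IsPrimitiveRoot z 5) :
    Function.Surjective ((MonoidHom.fst _ _).comp (simplexGroup z).subtype) := by
  intro σ
  rcases exists_simplexVertex_perm hz σ.1 with ⟨-, A, B, h⟩ | ⟨hs, -⟩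
  · refine ⟨⟨(σ, A, B⁻¹), fun i => ?_⟩, rfl⟩
    change simplexVertex z (σ.1 i) * (B⁻¹ : GL (Fin 2) k).1 = _
    rw [h, mul_assoc, Units.mul_inv, mul_one]
  · rw [Perm.mem_alternatingGroup.1 σ.2] at hs
    exact absurd hs (by decide)

/-- The vertices of the simplex span the space of matrices, so a map `X ↦ A X B⁻¹` fixing all of
them is the identity, which forces `A` to be scalar. -/
theorem scalar_of_fix_simplexVertex [CharZero k] {z : k} (hz : IsPrimitiveRoot z 5)
    {A B : Matrix (Fin 2) (Fin 2) k} (h : ∀ i, simplexVertex z i * B = A * simplexVertex z i) :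
    A 0 1 = 0 ∧ A 1 0 = 0 ∧ A 0 0 = A 1 1 := by
  -- Distinct powers of `t` are linearly independent as functions on the fifth roots of unity.
  have hind {a b c d : k} (hp : ∀ i : Fin 5, a * z ^ (i : ℕ) + b * z ^ (2 * i : ℕ) +
      c * z ^ (3 * i : ℕ) + d * z ^ (4 * i : ℕ) = 0) : a = 0 ∧ b = 0 ∧ c = 0 ∧ d = 0 := by
    let p : Polynomial k := Polynomial.C a * Polynomial.X + Polynomial.C b * Polynomial.X ^ 2 +
      Polynomial.C c * Polynomial.X ^ 3 + Polynomial.C d * Polynomial.X ^ 4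
    have hp0 : p = 0 := by
      refine Polynomial.eq_zero_of_natDegree_lt_card_of_eval_eq_zero p
        (f := fun i : Fin 5 => z ^ (i : ℕ)) ?_ ?_ ?_
      · intro i j hij
        exact Fin.ext (hz.pow_inj i.2 j.2 hij)
      · intro i
        rw [← hp i]
        simp only [p, Polynomial.eval_add, Polynomial.eval_mul, Polynomial.eval_C,
          Polynomial.eval_X, Polynomial.eval_pow]
        ring
      · have : p.natDegree ≤ 4 := by
          simp only [p]
          compute_degree
        simpa using Nat.lt_succ_of_le this
    have e (m : ℕ) := congrArg (fun q => Polynomial.coeff q m) hp0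
    have e1 := e 1
    have e2 := e 2
    have e3 := e 3
    have e4 := e 4
    simp [p, Polynomial.coeff_X_pow] at e1 e2 e3 e4
    exact ⟨e1, e2, e3, e4⟩
  have h00 := hind (a := B 0 0 - A 0 0) (b := B 1 0) (c := A 0 1) (d := 0) fun i => by
    have := congrFun (congrFun (h i) 0) 0
    simp [Matrix.mul_apply, simplexVertex] at this
    linear_combination this
  have h10 := hind (a := -A 1 0) (b := 0) (c := A 1 1 - B 0 0) (d := B 1 0) fun i => by
    have := congrFun (congrFun (h i) 1) 0
    simp [Matrix.mul_apply, simplexVertex] at this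
    linear_combination this
  exact ⟨h00.2.2.1, neg_eq_zero.1 h10.1, by linear_combination -h00.1 - h10.2.2.1⟩

/-- The icosahedral group: an embedding of `A₅` into the automorphism group of `k(x)`. The
fractional linear action of `A` depends only on the permutation `σ` in a triple `(σ, A, B)`, so
the action of the group of triples descends to `A₅`. -/
theorem exists_injective_altFive_ratFunc [CharZero k] {z : k} (hz : IsPrimitiveRoot z 5) :
    ∃ f : AltFive →* (RatFunc k ≃ₐ[k] RatFunc k), Function.Injective f := by
  let S := simplexGroup z
  let π : S →* AltFive := (MonoidHom.fst _ _).comp S.subtype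
  let ρ : S →* GL (Fin 2) k :=
    ((MonoidHom.fst _ _).comp (MonoidHom.snd _ _)).comp S.subtype
  have hπ : Function.Surjective π := simplexGroup_fst_surjective hz
  have hker : π.ker ≤ (moebiusAction.comp ρ).ker := by
    rintro ⟨⟨σ, A, B⟩, hp⟩ hσ
    have hσ1 : σ = 1 := hσ
    subst hσ1
    exact (moebiusAction_eq_one_iff A).2 (scalar_of_fix_simplexVertex hz hp)
  let f : AltFive →* (RatFunc k ≃ₐ[k] RatFunc k) := π.liftOfSurjective hπ ⟨_, hker⟩
  have hf (p : S) : f (π p) = moebiusAction (ρ p) :=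
    π.liftOfRightInverse_comp_apply _ _ ⟨_, hker⟩ p
  refine ⟨f, (MonoidHom.ker_eq_bot_iff f).1 ?_⟩
  refine (IsSimpleGroup.eq_bot_or_eq_top_of_normal _ inferInstance).resolve_right fun htop => ?_
  -- Otherwise `(0 1)(2 3)` is induced by right multiplication alone; as it fixes the invertible
  -- vertex `4`, it would be trivial.
  obtain ⟨p, hp⟩ := hπ ⟨swap 0 1 * swap 2 3, Perm.mem_alternatingGroup.2 (by decide)⟩
  have h1 : moebiusAction (ρ p) = 1 := by
    rw [← hf]
    exact (MonoidHom.mem_ker (f := f)).1 (htop ▸ Subgroup.mem_top _)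
  obtain ⟨h01, h10, h00⟩ := (moebiusAction_eq_one_iff _).1 h1
  obtain ⟨⟨σ, A, B⟩, hmem⟩ := p
  have hσ : σ.1 = swap 0 1 * swap 2 3 := congrArg Subtype.val hp
  replace h01 : A 0 1 = 0 := h01
  replace h10 : A 1 0 = 0 := h10
  replace h00 : A 0 0 = A 1 1 := h00
  have hA : A.1 = A 0 0 • (1 : Matrix (Fin 2) (Fin 2) k) := by
    ext i j
    fin_cases i <;> fin_cases j <;> simp [h01, h10, h00]
  have ha : A 0 0 ≠ 0 := by
    intro h0
    have hdet := A.det.ne_zero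
    rw [Matrix.GeneralLinearGroup.val_det_apply, Matrix.det_fin_two, h0, h10] at hdet
    simp at hdet
  have hB (i : Fin 5) : simplexVertex z (σ.1 i) * B.1 = A 0 0 • simplexVertex z i := by
    have := hmem i
    change simplexVertex z (σ.1 i) * B.1 = A.1 * simplexVertex z i at this
    rw [this, hA]
    simp
  have hinv : IsUnit (simplexVertex z 4) := by
    rw [Matrix.isUnit_iff_isUnit_det, simplexVertex, Matrix.det_fin_two_of, isUnit_iff_ne_zero]
    have h5 := hz.pow_eq_one
    have : z ^ ((4 : Fin 5) : ℕ) * z ^ (4 * (4 : Fin 5) : ℕ) -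
        z ^ (2 * (4 : Fin 5) : ℕ) * -z ^ (3 * (4 : Fin 5) : ℕ) = 2 * (z ^ 5) ^ 4 := by
      norm_num
      ring
    rw [this, h5]
    norm_num
  have hB1 : B.1 = A 0 0 • (1 : Matrix (Fin 2) (Fin 2) k) := by
    have h4 := hB 4
    rw [hσ, show (swap 0 1 * swap 2 3 : Perm (Fin 5)) 4 = 4 by decide] at h4
    apply hinv.mul_left_cancel
    rw [h4, mul_smul_comm, mul_one]
  have hvert := hB 0
  rw [hσ, show (swap 0 1 * swap 2 3 : Perm (Fin 5)) 0 = 1 by decide, hB1, mul_smul_comm,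
    mul_one] at hvert
  have := congrFun (congrFun (smul_right_injective _ ha hvert) 0) 0
  simp [simplexVertex] at this
  exact hz.ne_one (by norm_num) this

end Icosahedral

/-! ### Saturation of fields of invariants -/

/-- The variable `X` is a generative element of every nonconstant rational function in one
variable, so a proper subfield of `k(x)` that contains a nonconstant function is not
saturated. -/
theorem eq_top_of_isSaturated {k : Type*} [Field k] {L : IntermediateField k (RatFunc k)}
    (hL : L ≠ ⊥) (hsat : IsSaturated L) : L = ⊤ := by
  obtain ⟨φ, hφ, hφk⟩ : ∃ φ ∈ L, φ ∉ (algebraMap k (RatFunc k)).range := by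
    by_contra! h
    exact hL (le_bot_iff.1 fun φ hφ => mem_bot.2 (h φ hφ))
  have hX : RatFunc.X ∈ L := by
    refine hsat φ hφ hφk RatFunc.X ⟨⟨?_, fun y _ => ?_⟩, ?_⟩
    · rintro ⟨c, hc⟩
      exact RatFunc.transcendental_X (K := k) (hc ▸ isAlgebraic_algebraMap c)
    · rw [RatFunc.adjoin_X]; trivial
    · rw [RatFunc.adjoin_X]; trivial
  rw [eq_top_iff, ← RatFunc.adjoin_X]
  exact adjoin_simple_le_iff.2 hX

/-- `k(x)` is finite over the field of invariants of a finite group, which therefore contains a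
nonconstant function; and it is a proper subfield if the group is nontrivial. -/
theorem not_isSaturated_fixedField {k : Type*} [Field k] (H : Subgroup (RatFunc k ≃ₐ[k] RatFunc k))
    [Finite H] (hH : H ≠ ⊥) : ¬ IsSaturated (fixedField H) := by
  intro hsat
  have hfin : FiniteDimensional (fixedField H) (RatFunc k) :=
    inferInstanceAs (FiniteDimensional (FixedPoints.subfield H (RatFunc k)) (RatFunc k))
  have hbot : fixedField H ≠ ⊥ := by
    intro h
    have halg : IsAlgebraic (fixedField H) (RatFunc.X : RatFunc k) :=
      Algebra.IsAlgebraic.isAlgebraic _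
    rw [h] at halg
    exact RatFunc.transcendental_X (K := k) (halg.restrictScalars k)
  have htop := eq_top_of_isSaturated hbot hsat
  refine hH (eq_bot_iff.2 fun σ hσ => Subgroup.mem_bot.2 (AlgEquiv.ext fun x => ?_))
  have hx : x ∈ fixedField H := htop ▸ mem_top
  exact hx ⟨σ, hσ⟩

/-- The permutation matrices of even permutations form a linear group isomorphic to `A₅`. -/
theorem exists_subgroup_GL_mulEquiv_altFive (k : Type*) [Field k] :
    ∃ G : Subgroup (GL (Fin 5) k), Nonempty (G ≃* AltFive) := by
  let f : Equiv.Perm (Fin 5) →* GL (Fin 5) k := (Matrix.permMatrixHom (R := k)).toHomUnits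
  have hf : Function.Injective f := by
    intro σ τ h
    have h1 : (σ⁻¹).permMatrix k = (τ⁻¹).permMatrix k := congrArg Units.val h
    have h2 := PEquiv.toMatrix_injective h1
    refine inv_injective (Equiv.ext fun i => ?_)
    simpa [Equiv.toPEquiv_apply] using congrArg (fun p : Fin 5 ≃. Fin 5 => p i) h2
  have hinj : Function.Injective (f.comp (alternatingGroup (Fin 5)).subtype) :=
    hf.comp Subtype.val_injective
  exact ⟨_, ⟨(MonoidHom.ofInjective hinj).symm⟩⟩

theorem corollary1 :
    -- finite linear groups isomorphic to `A₅` have saturated fields of invariants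
    (∀ (k : Type*) [Field k] [IsAlgClosed k] [CharZero k] (n : ℕ) (G : Subgroup (GL (Fin n) k)),
      Nonempty (G ≃* AltFive) → IsSaturated (linInvariants G)) ∧
    -- there is a group of automorphisms of `ℂ(x)` isomorphic to `A₅`, and none of these groups
    -- has a saturated field of invariants
    ((∃ H : Subgroup (RatFunc ℂ ≃ₐ[ℂ] RatFunc ℂ), Nonempty (H ≃* AltFive)) ∧
      ∀ H : Subgroup (RatFunc ℂ ≃ₐ[ℂ] RatFunc ℂ), Nonempty (H ≃* AltFive) →
        ¬ IsSaturated (fixedField H)) ∧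
    -- over the same field `ℂ`, linear groups isomorphic to `A₅` exist, so that saturation
    -- is not determined by the field and the abstract group
    (∃ (n : ℕ) (G : Subgroup (GL (Fin n) ℂ)),
      Nonempty (G ≃* AltFive) ∧ IsSaturated (linInvariants G)) := by
  refine ⟨fun k _ _ _ n G ⟨e⟩ => isSaturated_linInvariants_of_altFive G e, ⟨?_, ?_⟩, ?_⟩
  · obtain ⟨f, hf⟩ := exists_injective_altFive_ratFunc
      (Complex.isPrimitiveRoot_exp 5 (by norm_num))
    exact ⟨f.range, ⟨(MonoidHom.ofInjective hf).symm⟩⟩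
  · rintro H ⟨e⟩
    have : Finite H := Finite.of_equiv _ e.symm.toEquiv
    refine not_isSaturated_fixedField H fun hbot => ?_
    have : Subsingleton H := hbot ▸ inferInstance
    obtain ⟨t, ht, -⟩ := AltFive.exists_involution
    exact ht (e.symm.injective (Subsingleton.elim _ _))
  · obtain ⟨G, ⟨e⟩⟩ := exists_subgroup_GL_mulEquiv_altFive ℂ
    exact ⟨5, G, ⟨e⟩, isSaturated_linInvariants_of_altFive G e⟩
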